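/- Let $L/K$ be a finite Galois extension of commutative fields with $L \neq K$. Say that $L$ has the linear matching property (over $K$) if for every $n \ge 1$, all $n$-dimensional $K$-subspaces $A, B$ of $L$ with $1 \notin B$, and every basis $\{a_1,\dots,a_n\}$ of $A$, there is a basis $\{b_1,\dots,b_n\}$ of $B$ such that, for all $i = 1,\dots,n$ and all $b \in B$, $$a_i b \in A \implies b \in \langle b_1,\dots,b_{i-1},b_{i+1},\dots,b_n\rangle_K .$$ Then $L$ has the linear matching property if and only if the degree $[L:K]$ is prime. -/

import Mathlib

namespace LinearMatching

variable {K L : Type*} [Field K] [DivisionRing L] [Algebra K L]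

/-- An (ordered) basis `a` of the `K`-subspace `A` is matched to the (ordered) basis `b` of the
`K`-subspace `B`: for all `i` and all `x ∈ B`, if `a i * x ∈ A` then `x` lies in the
hyperplane of `B` spanned by the `b j` with `j ≠ i`. -/
def BasisMatched {n : ℕ} {A B : Submodule K L}
    (a : Module.Basis (Fin n) K A) (b : Module.Basis (Fin n) K B) : Prop :=
  ∀ i : Fin n, ∀ x ∈ B, (a i : L) * x ∈ A →
    x ∈ Submodule.span K ((fun j : Fin n => (b j : L)) '' {j : Fin n | j ≠ i})

/-- For `n`-dimensional subspaces `A`, `B`: every basis of `A` can be matched to a basis of `B`. -/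
def SubspaceMatched (n : ℕ) (A B : Submodule K L) : Prop :=
  ∀ a : Module.Basis (Fin n) K A, ∃ b : Module.Basis (Fin n) K B, BasisMatched a b

variable (K L) in
/-- The linear matching property of the extension `K ⊆ L`. (For `n ≥ 1`, `finrank = n` entails
finite-dimensionality.) -/
def LinearMatchingProperty : Prop :=
  ∀ n : ℕ, 1 ≤ n → ∀ A B : Submodule K L,
    Module.finrank K A = n → Module.finrank K B = n → (1 : L) ∉ B → SubspaceMatched n A B

end LinearMatching

/-!
For the direction from prime degree to matching, fix a basis `a` of `A` and put
`V i = {x ∈ B | a i * x ∈ A}`. The basis `a` is matched to a basis `b` of `B` exactly when, for each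
`i`, the `i`-th coordinate functional of `b` vanishes on `V i`. So what is needed is a linearly
independent system of `n` functionals on `B`, the `i`-th one vanishing on `V i`. Rado's theorem on
independent transversals of a family of subspaces
(`exists_linearIndependent_mem_of_card_le_finrank_sup`), applied to the annihilators of the `V i`,
reduces this to the inequality `dim (⨅ i ∈ J, V i) ≤ n - |J|` for all nonempty sets `J` of indices.
If `U` denotes the intersection and `A_J` the span of the `a i` with `i ∈ J`, then
`A_J (K + U) ⊆ A`, where `K + U` has dimension `dim U + 1` because `1 ∉ B`. Since `A ≠ L`, the
inequality follows from the linear Cauchy–Davenport inequality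
`dim A + dim B - 1 ≤ dim (A B)` for `A B` of dimension less than `[L : K]`, which holds when there
is no intermediate ring strictly between `K` and `L`
(`finrank_add_finrank_le_finrank_mul_add_one`). It is proved with the Dyson transform
`(A, B) ↦ (e⁻¹ A ∩ B, e⁻¹ A + B)`.

Conversely, if the degree is not prime, Cauchy's theorem in the Galois group gives an intermediate
field `F` different from `K` and `L`. Take `A = F` and `B = H + K x`, with `H` a complement of `K`
in `F` and `x ∉ F`. If some basis of `A` were matched to a basis `b` of `B`, then `H` would lie in
all the hyperplanes spanned by all but one of the `b j`, hence would be zero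
(`not_subspaceMatched_of_mem`).
-/

open Module

namespace LinearMatching

/-! ### Independent transversals of families of subspaces -/

section Rado

variable {K V ι : Type*} [Field K] [AddCommGroup V] [Module K V]

/-- A subspace of dimension at least two is the sum of two proper subspaces. -/
theorem exists_lt_lt_sup_eq_of_one_lt_finrank (W : Submodule K V) (hW : 1 < finrank K W) :
    ∃ U₁ U₂ : Submodule K V, U₁ < W ∧ U₂ < W ∧ U₁ ⊔ U₂ = W := by
  have hW0 : W ≠ ⊥ := by
    rintro rfl
    simp at hW
  obtain ⟨x, hxW, hx0⟩ := W.exists_mem_ne_zero_of_ne_bot hW0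
  obtain ⟨C, hC⟩ := exists_isCompl (Submodule.span K {x})
  have hle : Submodule.span K {x} ≤ W := by simpa using hxW
  refine ⟨Submodule.span K {x}, C ⊓ W, lt_of_le_of_ne hle ?_,
    lt_of_le_of_ne inf_le_right ?_, ?_⟩
  · intro h
    rw [← h, finrank_span_singleton hx0] at hW
    exact lt_irrefl _ hW
  · intro h
    have hxC : x ∈ C := (h.symm ▸ hxW : x ∈ C ⊓ W).1
    exact hx0 (Submodule.disjoint_def.1 hC.disjoint x (Submodule.mem_span_singleton_self x) hxC)
  · rw [← sup_inf_assoc_of_le _ hle, hC.sup_eq_top, top_inf_eq]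

variable [DecidableEq ι]

theorem finset_sup_update_of_notMem (W : ι → Submodule K V) {i : ι} (U : Submodule K V)
    {s : Finset ι} (hi : i ∉ s) : s.sup (Function.update W i U) = s.sup W :=
  Finset.sup_congr rfl fun j hj => by
    rw [Function.update_of_ne]
    rintro rfl
    exact hi hj

/-- If shrinking `W i` to `U` destroys the rank condition, this is witnessed by a set of indices
not containing `i`. -/
theorem exists_finrank_sup_le_card_of_update {W : ι → Submodule K V} {i : ι} {U : Submodule K V}
    (hW : ∀ s : Finset ι, s.card ≤ finrank K (s.sup W : Submodule K V))
    (hU : ¬ ∀ s : Finset ι,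
      s.card ≤ finrank K (s.sup (Function.update W i U) : Submodule K V)) :
    ∃ t : Finset ι, i ∉ t ∧ finrank K (U ⊔ t.sup W : Submodule K V) ≤ t.card := by
  push Not at hU
  obtain ⟨s, hs⟩ := hU
  have hi : i ∈ s := by
    by_contra hi
    rw [finset_sup_update_of_notMem W U hi] at hs
    exact absurd (hW s) (not_le.2 hs)
  refine ⟨s.erase i, Finset.notMem_erase i s, ?_⟩
  rw [← Finset.insert_erase hi, Finset.sup_insert, Function.update_self,
    finset_sup_update_of_notMem W U (Finset.notMem_erase i s),
    Finset.card_insert_of_notMem (Finset.notMem_erase i s)] at hs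
  omega

variable [FiniteDimensional K V]

/-- Rado's theorem for subspaces: a finite family of subspaces, any `k` of which span a subspace of
dimension at least `k`, admits a linearly independent system of representatives. The subspaces
are shrunk, keeping the condition, until all of them are lines; by submodularity of the
dimension, one of two proper subspaces spanning `W i` can always replace `W i`. -/
theorem exists_linearIndependent_mem_of_card_le_finrank_sup [Fintype ι] (W : ι → Submodule K V)
    (hW : ∀ s : Finset ι, s.card ≤ finrank K (s.sup W : Submodule K V)) :
    ∃ f : ι → V, LinearIndependent K f ∧ ∀ i, f i ∈ W i := by
  induction hN : ∑ i, finrank K (W i) using Nat.strong_induction_on generalizing W with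
  | _ N ih =>
  by_cases hbig : ∃ i, 1 < finrank K (W i)
  · obtain ⟨i, hi⟩ := hbig
    have shrink : ∀ U < W i, (∀ s : Finset ι,
        s.card ≤ finrank K (s.sup (Function.update W i U) : Submodule K V)) →
        ∃ f : ι → V, LinearIndependent K f ∧ ∀ i, f i ∈ W i := by
      intro U hU hcond
      have hle : ∀ j, Function.update W i U j ≤ W j := by
        intro j
        rcases eq_or_ne j i with rfl | hj
        · simpa using hU.le
        · simp [hj]
      obtain ⟨f, hf, hmem⟩ := ih _ (by
        rw [← hN]
        refine Finset.sum_lt_sum (fun j _ => Submodule.finrank_mono (hle j))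
          ⟨i, Finset.mem_univ i, ?_⟩
        rw [Function.update_self]
        exact Submodule.finrank_lt_finrank_of_lt hU) (Function.update W i U) hcond rfl
      exact ⟨f, hf, fun j => hle j (hmem j)⟩
    obtain ⟨U₁, U₂, h₁, h₂, hsup⟩ := exists_lt_lt_sup_eq_of_one_lt_finrank (W i) hi
    by_contra hno
    obtain ⟨s, his, hs⟩ :=
      exists_finrank_sup_le_card_of_update hW fun h => hno (shrink U₁ h₁ h)
    obtain ⟨t, hit, ht⟩ :=
      exists_finrank_sup_le_card_of_update hW fun h => hno (shrink U₂ h₂ h)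
    have hadd := Submodule.finrank_sup_add_finrank_inf_eq (U₁ ⊔ s.sup W) (U₂ ⊔ t.sup W)
    have hunion : (insert i (s ∪ t)).sup W = (U₁ ⊔ s.sup W) ⊔ (U₂ ⊔ t.sup W) := by
      rw [Finset.sup_insert, Finset.sup_union, sup_sup_sup_comm, hsup]
    have hinter : (s ∩ t).sup W ≤ (U₁ ⊔ s.sup W) ⊓ (U₂ ⊔ t.sup W) :=
      le_inf ((Finset.sup_mono Finset.inter_subset_left).trans le_sup_right)
        ((Finset.sup_mono Finset.inter_subset_right).trans le_sup_right)
    have h1 := hW (insert i (s ∪ t))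
    rw [hunion, Finset.card_insert_of_notMem (by simp [his, hit])] at h1
    have h2 := (hW (s ∩ t)).trans (Submodule.finrank_mono hinter)
    have h3 := Finset.card_union_add_card_inter s t
    omega
  · push Not at hbig
    have hone : ∀ i, ∃ v : V, Submodule.span K {v} = W i := by
      intro i
      have h1 : 1 ≤ finrank K (W i) := by simpa using hW {i}
      obtain ⟨v, -, hv⟩ := finrank_eq_one_iff'.1 (le_antisymm (hbig i) h1)
      refine ⟨v, le_antisymm (by simp) fun w hw => ?_⟩
      obtain ⟨c, hc⟩ := hv ⟨w, hw⟩
      exact Submodule.mem_span_singleton.2 ⟨c, congrArg Subtype.val hc⟩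
    choose f hf using hone
    refine ⟨f, ?_, fun i => hf i ▸ Submodule.mem_span_singleton_self _⟩
    rw [linearIndependent_iff_card_le_finrank_span]
    refine (hW Finset.univ).trans (Submodule.finrank_mono (Finset.sup_le fun i _ => ?_))
    rw [← hf i]
    exact Submodule.span_mono (by simp)

/-- The dual form of Rado's theorem: if the intersection of any `k` of the subspaces `W i` has
codimension at least `k`, then there is a basis whose `i`-th coordinate vanishes on `W i`. -/
theorem exists_basis_repr_eq_zero [Fintype ι] (hι : Fintype.card ι = finrank K V)
    (W : ι → Submodule K V)
    (hW : ∀ s : Finset ι, s.card + finrank K (s.inf W : Submodule K V) ≤ finrank K V) :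
    ∃ b : Basis ι K V, ∀ i, ∀ x ∈ W i, b.repr x i = 0 := by
  have hann : ∀ s : Finset ι,
      s.sup (fun i => (W i).dualAnnihilator) = (s.inf W).dualAnnihilator := by
    intro s
    induction s using Finset.induction_on with
    | empty => simp
    | insert i s hi ih =>
      rw [Finset.sup_insert, Finset.inf_insert, Subspace.dualAnnihilator_inf_eq, ih]
  obtain ⟨f, hf, hmem⟩ := exists_linearIndependent_mem_of_card_le_finrank_sup
    (fun i => (W i).dualAnnihilator) fun s => by
      rw [hann]
      have := Subspace.finrank_add_finrank_dualAnnihilator_eq (s.inf W)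
      have := hW s
      omega
  let c : Basis ι K (Dual K V) :=
    basisOfLinearIndependentOfCardEqFinrank' f hf (by rw [hι, Subspace.dual_finrank_eq])
  -- `b` is the basis of `V` with dual basis `f`.
  let b : Basis ι K V := c.dualBasis.map (evalEquiv K V).symm
  have hb : ∀ i j, f i (b j) = if i = j then 1 else 0 := by
    intro i j
    have : f i = c i := by simp [c]
    rw [this]
    simp [b, Finsupp.single_apply]
  refine ⟨b, fun i x hx => ?_⟩
  have h0 : f i x = 0 := (Submodule.mem_dualAnnihilator _).1 (hmem i) x hx
  have hsum := congrArg (f i) (b.sum_repr x)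
  rw [h0, map_sum] at hsum
  simpa [hb] using hsum

end Rado

/-! ### The linear Cauchy–Davenport inequality -/

section CauchyDavenport

variable {K L : Type*} [Field K] [Field L] [Algebra K L]

theorem finrank_span_singleton_mul {c : L} (hc : c ≠ 0) (A : Submodule K L) :
    finrank K (Submodule.span K {c} * A : Submodule K L) = finrank K A := by
  have h : Submodule.span K {c} * A = A.map (LinearMap.mulLeft K c) := by
    ext x
    simp [Submodule.mem_span_singleton_mul]
  rw [h]
  exact (Submodule.equivMapOfInjective _ (mul_right_injective₀ hc) A).finrank_eq.symm

/-- The subalgebra of all `x` with `x B ⊆ B`. -/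
def stabilizerSubalgebra (B : Submodule K L) : Subalgebra K L where
  carrier := {x | ∀ b ∈ B, x * b ∈ B}
  mul_mem' hx hy b hb := by
    rw [mul_assoc]
    exact hx _ (hy b hb)
  add_mem' hx hy b hb := by
    rw [add_mul]
    exact B.add_mem (hx b hb) (hy b hb)
  algebraMap_mem' r b hb := by
    rw [← Algebra.smul_def]
    exact B.smul_mem r hb

variable [FiniteDimensional K L] [IsSimpleOrder (Subalgebra K L)]

/-- The case of the linear Cauchy–Davenport inequality in which every Dyson transform is trivial:
the stabilizer of `B` then contains `a⁻¹ A`. -/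
theorem finrank_add_finrank_le_of_forall_mul_mem {A B : Submodule K L} (hB : B ≠ ⊥)
    {a : L} (ha : a ∈ A) (ha0 : a ≠ 0) (hlt : finrank K (A * B : Submodule K L) < finrank K L)
    (hstab : ∀ a' ∈ A, ∀ b ∈ B, a⁻¹ * a' * b ∈ B) :
    finrank K A + finrank K B ≤ finrank K (A * B : Submodule K L) + 1 := by
  have hspan : Submodule.span K {a} ≤ A := by simpa using ha
  have hB_le : finrank K B ≤ finrank K (A * B : Submodule K L) := by
    rw [← finrank_span_singleton_mul ha0 B]
    exact Submodule.finrank_mono (mul_le_mul' hspan le_rfl)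
  have hmem : ∀ a' ∈ A, a⁻¹ * a' ∈ stabilizerSubalgebra B := hstab
  rcases eq_bot_or_eq_top (stabilizerSubalgebra B) with h | h
  · have hA : A ≤ Submodule.span K {a} := by
      intro a' ha'
      have := hmem a' ha'
      rw [h, Algebra.mem_bot] at this
      obtain ⟨r, hr⟩ := this
      refine Submodule.mem_span_singleton.2 ⟨r, ?_⟩
      rw [Algebra.smul_def, hr]
      field_simp
    have := Submodule.finrank_mono hA
    rw [finrank_span_singleton ha0] at this
    omega
  · obtain ⟨b, hb, hb0⟩ := B.exists_mem_ne_zero_of_ne_bot hB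
    have hBtop : B = ⊤ := by
      refine eq_top_iff.2 fun x _ => ?_
      have hx : x * b⁻¹ ∈ stabilizerSubalgebra B := h ▸ Algebra.mem_top
      have := hx b hb
      rwa [inv_mul_cancel_right₀ hb0] at this
    rw [hBtop, finrank_top] at hB_le
    rw [hBtop] at hlt
    omega

/-- The linear Cauchy–Davenport inequality. -/
theorem finrank_add_finrank_le_finrank_mul_add_one {A B : Submodule K L} (hA : A ≠ ⊥)
    (hB : B ≠ ⊥) (hlt : finrank K (A * B : Submodule K L) < finrank K L) :
    finrank K A + finrank K B ≤ finrank K (A * B : Submodule K L) + 1 := by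
  induction hN : finrank K A using Nat.strong_induction_on generalizing A B with
  | _ N ih =>
  by_cases htriv : ∀ a ∈ A, a ≠ 0 → ∀ a' ∈ A, ∀ b ∈ B, a⁻¹ * a' * b ∈ B
  · obtain ⟨a, ha, ha0⟩ := A.exists_mem_ne_zero_of_ne_bot hA
    rw [← hN]
    exact finrank_add_finrank_le_of_forall_mul_mem hB ha ha0 hlt (htriv a ha ha0)
  · push Not at htriv
    obtain ⟨a, ha, ha0, a', ha', b, hb, hnot⟩ := htriv
    have hb0 : b ≠ 0 := by
      rintro rfl
      simp at hnot
    have he0 : a⁻¹ * b ≠ 0 := mul_ne_zero (inv_ne_zero ha0) hb0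
    -- The Dyson transform with `e = a b⁻¹`; `A₁ = e⁻¹ A` meets `B` in `b`, but is not inside `B`.
    set A₁ := Submodule.span K {a⁻¹ * b} * A with hA₁
    have hrank : finrank K A₁ = N := by rw [hA₁, finrank_span_singleton_mul he0, hN]
    have hbA₁ : b ∈ A₁ := Submodule.mem_span_singleton_mul.2 ⟨a, ha, by field_simp⟩
    have hnle : ¬ A₁ ≤ B := fun h =>
      hnot (h (Submodule.mem_span_singleton_mul.2 ⟨a', ha', by ring⟩))
    have hinf : A₁ ⊓ B ≠ ⊥ := (Submodule.ne_bot_iff _).2 ⟨b, ⟨hbA₁, hb⟩, hb0⟩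
    have hsup : A₁ ⊔ B ≠ ⊥ := (Submodule.ne_bot_iff _).2 ⟨b, le_sup_right (a := A₁) hb, hb0⟩
    have hmul : (A₁ ⊓ B) * (A₁ ⊔ B) ≤ A₁ * B := by
      rw [Submodule.mul_sup]
      refine sup_le ?_ (mul_le_mul' inf_le_left le_rfl)
      rw [mul_comm]
      exact mul_le_mul' le_rfl inf_le_right
    have hle : finrank K ((A₁ ⊓ B) * (A₁ ⊔ B) : Submodule K L) ≤
        finrank K (A * B : Submodule K L) := by
      refine (Submodule.finrank_mono hmul).trans_eq ?_
      rw [hA₁, mul_assoc, finrank_span_singleton_mul he0]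
    have hdec : finrank K (A₁ ⊓ B : Submodule K L) < N := by
      rw [← hrank]
      exact Submodule.finrank_lt_finrank_of_lt (inf_lt_left.2 hnle)
    have := ih _ hdec hinf hsup (hle.trans_lt hlt) rfl
    have := Submodule.finrank_sup_add_finrank_inf_eq A₁ B
    omega

end CauchyDavenport

/-! ### Extensions of prime degree -/

section Matched

variable {K L : Type*} [Field K] [Field L] [Algebra K L] [FiniteDimensional K L]

theorem finrank_span_one_sup {U : Submodule K L} (hU : (1 : L) ∉ U) :
    finrank K (Submodule.span K {1} ⊔ U : Submodule K L) = finrank K U + 1 := by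
  have hdisj : Submodule.span K {(1 : L)} ⊓ U = ⊥ :=
    disjoint_iff.1 (Submodule.disjoint_span_singleton' one_ne_zero |>.2 hU).symm
  have := Submodule.finrank_sup_add_finrank_inf_eq (Submodule.span K {(1 : L)}) U
  rw [hdisj, finrank_bot, finrank_span_singleton one_ne_zero] at this
  omega

/-- If `A₀ U ⊆ A` for some `A₀ ⊆ A`, then Cauchy–Davenport applies to `A₀ (K + U) ⊆ A`. -/
theorem finrank_add_finrank_le_of_mul_le [IsSimpleOrder (Subalgebra K L)]
    {A A₀ U : Submodule K L} (hA₀ : A₀ ≠ ⊥) (hle : A₀ ≤ A) (hmul : A₀ * U ≤ A)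
    (hU : (1 : L) ∉ U) (hA : finrank K A < finrank K L) :
    finrank K A₀ + finrank K U ≤ finrank K A := by
  have hprod : A₀ * (Submodule.span K {1} ⊔ U) ≤ A := by
    rw [Submodule.mul_sup, ← Submodule.one_eq_span, mul_one]
    exact sup_le hle hmul
  have hrank := Submodule.finrank_mono hprod
  have hne : Submodule.span K {(1 : L)} ⊔ U ≠ ⊥ := (Submodule.ne_bot_iff _).2
    ⟨1, le_sup_left (b := U) (Submodule.mem_span_singleton_self (1 : L)), one_ne_zero⟩
  have := finrank_add_finrank_le_finrank_mul_add_one hA₀ hne (hrank.trans_lt hA)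
  rw [finrank_span_one_sup hU] at this
  omega

theorem subspaceMatched_of_isSimpleOrder [IsSimpleOrder (Subalgebra K L)] {n : ℕ}
    {A B : Submodule K L} (hA : finrank K A = n) (hB : finrank K B = n) (h1 : (1 : L) ∉ B) :
    SubspaceMatched n A B := by
  intro a
  have hlt : n < finrank K L := by
    rw [← hB]
    exact Submodule.finrank_lt fun h => h1 (h ▸ Submodule.mem_top)
  let W : Fin n → Submodule K B := fun i =>
    A.comap ((LinearMap.mulLeft K (a i : L)).comp B.subtype)
  obtain ⟨b, hb⟩ := exists_basis_repr_eq_zero (by rw [Fintype.card_fin, hB]) W (by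
    intro s
    rcases s.eq_empty_or_nonempty with rfl | ⟨i₀, hi₀⟩
    · simpa using Submodule.finrank_le _
    have hind : LinearIndependent K fun i : s => (a i : L) :=
      (a.linearIndependent.map' A.subtype A.ker_subtype).comp _ Subtype.val_injective
    have hcard := finrank_span_eq_card hind
    rw [Fintype.card_coe] at hcard
    have hrange : ∀ v ∈ Set.range (fun i : s => (a i : L)), ∃ i ∈ s, (a i : L) = v := by
      rintro _ ⟨i, rfl⟩
      exact ⟨i, i.2, rfl⟩
    have := finrank_add_finrank_le_of_mul_le (A := A)
      (A₀ := Submodule.span K (Set.range fun i : s => (a i : L)))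
      (U := (s.inf W).map B.subtype) ?_ ?_ ?_ ?_ (hA.trans_lt hlt)
    · rw [hcard, Submodule.finrank_map_subtype_eq] at this
      exact this.trans_eq (hA.trans hB.symm)
    · rw [Submodule.ne_bot_iff]
      exact ⟨a i₀, Submodule.subset_span ⟨⟨i₀, hi₀⟩, rfl⟩, by simpa using a.ne_zero i₀⟩
    · refine Submodule.span_le.2 fun v hv => ?_
      obtain ⟨i, -, rfl⟩ := hrange v hv
      exact (a i).2
    · rw [Submodule.mul_le]
      rintro v hv _ ⟨u, hu, rfl⟩
      have : Submodule.span K (Set.range fun i : s => (a i : L)) ≤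
          A.comap (LinearMap.mulRight K (u : L)) := by
        refine Submodule.span_le.2 fun v hv => ?_
        obtain ⟨i, hi, rfl⟩ := hrange v hv
        exact (Finset.inf_le hi : s.inf W ≤ W i) hu
      exact this hv
    · rintro ⟨u, -, hu⟩
      exact h1 (hu ▸ u.2))
  refine ⟨b, fun i x hx hax => ?_⟩
  have h0 : b.repr ⟨x, hx⟩ i = 0 := hb i _ hax
  have hsum := congrArg B.subtype (b.sum_repr ⟨x, hx⟩)
  rw [map_sum] at hsum
  have hx' : ∑ j, b.repr ⟨x, hx⟩ j • (b j : L) = x := by simpa using hsum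
  rw [← hx']
  refine Submodule.sum_mem _ fun j _ => ?_
  rcases eq_or_ne j i with rfl | hj
  · simp [h0]
  · exact Submodule.smul_mem _ _ (Submodule.subset_span ⟨j, hj, rfl⟩)

/-! ### Extensions with a proper intermediate field -/

/-- A nonzero `y ∈ B` with `a y ∈ A` for all `a ∈ A` is an obstruction to matching: it would lie in
each of the hyperplanes spanned by all but one of the vectors of a basis of `B`. -/
theorem not_subspaceMatched_of_mem {n : ℕ} {A B : Submodule K L} (hA : finrank K A = n)
    {y : L} (hyB : y ∈ B) (hy0 : y ≠ 0) (hy : ∀ a ∈ A, a * y ∈ A) :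
    ¬ SubspaceMatched n A B := by
  intro h
  obtain ⟨b, hb⟩ := h (finBasisOfFinrankEq K A hA)
  have hzero : ∀ i, b.repr ⟨y, hyB⟩ i = 0 := by
    intro i
    have hmem := hb i y hyB (hy _ (Subtype.mem _))
    have himage : (fun j : Fin n => (b j : L)) '' {j | j ≠ i} =
        B.subtype '' (b '' {j | j ≠ i}) := by
      rw [Set.image_image]
      rfl
    rw [himage, ← Submodule.map_span] at hmem
    obtain ⟨z, hz, hzy⟩ := hmem
    have hz' : (⟨y, hyB⟩ : B) = z := Subtype.ext hzy.symm
    rw [hz']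
    have hsupp := b.mem_span_image.1 hz
    by_contra hne
    exact hsupp (Finsupp.mem_support_iff.2 hne) rfl
  have : (⟨y, hyB⟩ : B) = 0 := b.repr.map_eq_zero_iff.1 (Finsupp.ext hzero)
  exact hy0 (congrArg Subtype.val this)

theorem not_linearMatchingProperty_of_intermediateField {F : IntermediateField K L}
    (hbot : F ≠ ⊥) (htop : F ≠ ⊤) : ¬ LinearMatchingProperty K L := by
  intro hL
  set A : Submodule K L := Subalgebra.toSubmodule F.toSubalgebra with hAdef
  have hmemA : ∀ {x : L}, x ∈ A ↔ x ∈ F := Iff.rfl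
  obtain ⟨x, hx⟩ : ∃ x, x ∉ F := by
    by_contra! h
    exact htop (eq_top_iff.2 fun x _ => h x)
  obtain ⟨C, hC⟩ := exists_isCompl (Submodule.span K {(1 : L)})
  have h1A : Submodule.span K {(1 : L)} ≤ A := by
    simpa using hmemA.2 F.one_mem
  -- `C ⊓ A` is a complement of `K` in `F`.
  have hsup : Submodule.span K {1} ⊔ C ⊓ A = A := by
    rw [← sup_inf_assoc_of_le _ h1A, hC.sup_eq_top, top_inf_eq]
  have h1C : (1 : L) ∉ C := fun h => one_ne_zero
    (Submodule.disjoint_def.1 hC.disjoint 1 (Submodule.mem_span_singleton_self 1) h)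
  have hrankA : finrank K A = finrank K (C ⊓ A : Submodule K L) + 1 := by
    rw [← finrank_span_one_sup (U := C ⊓ A) (fun h => h1C h.1), hsup]
  have hxA : x ∉ C ⊓ A := fun h => hx h.2
  have hx0 : x ≠ 0 := by
    rintro rfl
    exact hx F.zero_mem
  have hrankB : finrank K (C ⊓ A ⊔ Submodule.span K {x} : Submodule K L) =
      finrank K (C ⊓ A : Submodule K L) + 1 := by
    have := Submodule.finrank_sup_add_finrank_inf_eq (C ⊓ A) (Submodule.span K {x})
    rw [disjoint_iff.1 ((Submodule.disjoint_span_singleton' hx0).2 hxA), finrank_bot,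
      finrank_span_singleton hx0] at this
    omega
  have h1B : (1 : L) ∉ C ⊓ A ⊔ Submodule.span K {x} := by
    intro h
    obtain ⟨u, hu, v, hv, huv⟩ := Submodule.mem_sup.1 h
    obtain ⟨c, rfl⟩ := Submodule.mem_span_singleton.1 hv
    rcases eq_or_ne c 0 with rfl | hc
    · rw [zero_smul, add_zero] at huv
      exact h1C (huv ▸ hu.1)
    · refine hx ((Submodule.smul_mem_iff A hc).1 ?_)
      rw [← eq_sub_iff_add_eq'] at huv
      rw [huv]
      exact A.sub_mem (hmemA.2 F.one_mem) hu.2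
  have hne : C ⊓ A ≠ ⊥ := by
    intro h
    rw [h, sup_bot_eq, ← Submodule.one_eq_span] at hsup
    refine hbot (eq_bot_iff.2 fun z hz => ?_)
    rw [← hmemA, ← hsup, Submodule.mem_one] at hz
    exact IntermediateField.mem_bot.2 hz
  obtain ⟨y, hy, hy0⟩ := (C ⊓ A).exists_mem_ne_zero_of_ne_bot hne
  exact not_subspaceMatched_of_mem hrankA (Submodule.mem_sup_left hy) hy0
    (fun a ha => F.mul_mem ha hy.2)
    (hL _ (Nat.le_add_left 1 _) A _ hrankA hrankB h1B)

theorem exists_intermediateField_ne_of_not_prime [IsGalois K L] (h1 : finrank K L ≠ 1)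
    (hp : ¬ (finrank K L).Prime) : ∃ F : IntermediateField K L, F ≠ ⊥ ∧ F ≠ ⊤ := by
  have hcard : Nat.card Gal(L/K) = finrank K L := IsGalois.card_aut_eq_finrank K L
  obtain ⟨p, hpp, hdvd⟩ := Nat.exists_prime_and_dvd h1
  have : Fact p.Prime := ⟨hpp⟩
  obtain ⟨g, hg⟩ := exists_prime_orderOf_dvd_card' p (hcard.symm ▸ hdvd)
  have hrank : finrank (IntermediateField.fixedField (Subgroup.zpowers g)) L = p := by
    rw [IntermediateField.finrank_fixedField_eq_card, Nat.card_zpowers, hg]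
  refine ⟨IntermediateField.fixedField (Subgroup.zpowers g), fun h => ?_, fun h => ?_⟩
  · rw [h, IntermediateField.finrank_bot'] at hrank
    exact hp (hrank ▸ hpp)
  · rw [h, IntermediateField.finrank_top] at hrank
    exact hpp.one_lt.ne hrank

end Matched

end LinearMatching

theorem mainTheorem5 (K L : Type*) [Field K] [Field L] [Algebra K L]
    [FiniteDimensional K L] [IsGalois K L]
    (hKL : ¬ Function.Surjective (algebraMap K L)) :
    LinearMatching.LinearMatchingProperty K L ↔ (Module.finrank K L).Prime := by
  constructor
  · intro h
    by_contra hp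
    have h1 : finrank K L ≠ 1 := fun h1 => hKL fun x =>
      Algebra.mem_bot.1 ((Subalgebra.bot_eq_top_of_finrank_eq_one h1).symm ▸ Algebra.mem_top)
    obtain ⟨F, hbot, htop⟩ := LinearMatching.exists_intermediateField_ne_of_not_prime h1 hp
    exact LinearMatching.not_linearMatchingProperty_of_intermediateField hbot htop h
  · intro hp n _ A B hA hB h1
    have := Subalgebra.isSimpleOrder_of_finrank_prime K L hp
    exact LinearMatching.subspaceMatched_of_isSimpleOrder hA hB h1
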